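/- Let $K$ be a field, $n\ge 0$, and let $I=(x_1,\dots,x_n)$ be the augmentation ideal of the free associative algebra $K\langle x_1,\dots,x_n\rangle$. Let $\mathrm{Aut}_0(K\langle x_1,\dots,x_n\rangle)$ be the group of $K$-algebra automorphisms $g$ with $g(I)=I$, and for $N>1$ let $H_N$ be the subgroup of those $g$ with $g(x_i)\equiv x_i \pmod{I^N}$ for all $i$. Write $\mathrm{Aut}_0(\bar K\langle x_1,\dots,x_n\rangle)$ and $\bar H_N$ for the same groups over an algebraic closure $\bar K$ of $K$, and let $M_d\subset \mathrm{Aut}_0(\bar K\langle x_1,\dots,x_n\rangle)$ be the set of automorphisms $g$ such that all $g(x_i)$ have total degree at most $d$; the coordinates of $g$ are the coefficients of the $g(x_i)$. An Ind-scheme automorphism $\varphi\in\mathrm{Aut}_{\mathrm{Ind}}(\mathrm{Aut}_0(K\langle x_1,\dots,x_n\rangle))$ is a group automorphism of $\mathrm{Aut}_0(\bar K\langle x_1,\dots,x_n\rangle)$ such that both $\varphi$ and $\varphi^{-1}$ map each $M_d$ into some $M_e$ by a morphism defined over $K$ (Zariski-locally on $M_d$, every coordinate of the image is a quotient of two polynomials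 over $K$ in the coordinates of $g$), together with the group automorphism, again denoted $\varphi$, that it induces on the subgroup $\mathrm{Aut}_0(K\langle x_1,\dots,x_n\rangle)$ of $K$-points. Then every $\varphi\in\mathrm{Aut}_{\mathrm{Ind}}(\mathrm{Aut}_0(K\langle x_1,\dots,x_n\rangle))$ satisfies $\varphi(H_N)\subseteq H_N$ and $\varphi(\bar H_N)\subseteq\bar H_N$ for every $N>1$. -/

import Mathlib

/-! Automorphisms of the free associative algebra, the degree filtration, and automorphisms
of the resulting ind-group. -/

noncomputable section

namespace FreeAut

section Algebra

variable (R : Type*) [CommRing R] (n : ℕ)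

/-- The free associative algebra `R⟨x_1, …, x_n⟩`. -/
abbrev FA : Type _ := FreeAlgebra R (Fin n)

/-- The augmentation ideal: the two-sided ideal generated by the variables, as an `R`-submodule
(so that `augIdeal R n ^ N` is the `R`-span of the `N`-fold products of its elements, i.e. the
`N`-th power of the ideal for `1 ≤ N`). -/
def augIdeal : Submodule R (FA R n) :=
  Submodule.span R {f | ∃ (a b : FA R n) (i : Fin n), f = a * FreeAlgebra.ι R i * b}

variable {R n}

theorem ι_mem_augIdeal (i : Fin n) : FreeAlgebra.ι R i ∈ augIdeal R n :=
  Submodule.subset_span ⟨1, 1, i, by simp⟩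

theorem mul_mem_augIdeal (a b : FA R n) {f : FA R n} (hf : f ∈ augIdeal R n) :
    a * f * b ∈ augIdeal R n := by
  unfold augIdeal at hf
  induction hf using Submodule.span_induction with
  | mem x hx =>
    obtain ⟨c, d, i, rfl⟩ := hx
    exact Submodule.subset_span ⟨a * c, d * b, i, by simp only [mul_assoc]⟩
  | zero => simp
  | add x y _ _ hx hy => rw [mul_add, add_mul]; exact Submodule.add_mem _ hx hy
  | smul r x _ hx =>
    rw [mul_smul_comm, smul_mul_assoc]; exact Submodule.smul_mem _ r hx

theorem apply_mem_augIdeal (g : FA R n →ₐ[R] FA R n)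
    (hg : ∀ i, g (FreeAlgebra.ι R i) ∈ augIdeal R n) {f : FA R n} (hf : f ∈ augIdeal R n) :
    g f ∈ augIdeal R n := by
  unfold augIdeal at hf
  induction hf using Submodule.span_induction with
  | mem x hx =>
    obtain ⟨c, d, i, rfl⟩ := hx
    rw [map_mul, map_mul]
    exact mul_mem_augIdeal _ _ (hg i)
  | zero => simp
  | add x y _ _ hx hy => rw [map_add]; exact Submodule.add_mem _ hx hy
  | smul r x _ hx => rw [map_smul]; exact Submodule.smul_mem _ r hx

variable (R n)

/-- `Aut_0(R⟨x_1, …, x_n⟩)`: the `R`-algebra automorphisms that preserve the augmentation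
ideal. -/
def Aut0 : Subgroup (FA R n ≃ₐ[R] FA R n) where
  carrier := {g | (augIdeal R n).map g.toLinearMap = augIdeal R n}
  one_mem' := by
    show (augIdeal R n).map LinearMap.id = augIdeal R n
    exact Submodule.map_id _
  mul_mem' := by
    intro a b ha hb
    simp only [Set.mem_ofPred_eq] at ha hb ⊢
    have : (a * b).toLinearMap = a.toLinearMap ∘ₗ b.toLinearMap := rfl
    rw [this, Submodule.map_comp, hb, ha]
  inv_mem' := by
    intro a ha
    simp only [Set.mem_ofPred_eq] at ha ⊢
    have : (a⁻¹).toLinearMap ∘ₗ a.toLinearMap = LinearMap.id := by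
      ext x; exact a.symm_apply_apply x
    conv_lhs => rw [← ha, ← Submodule.map_comp, this, Submodule.map_id]

variable {R n}

theorem Aut0.apply_mem_pow (g : Aut0 R n) (N : ℕ) {f : FA R n} (hf : f ∈ augIdeal R n ^ N) :
    g.1 f ∈ augIdeal R n ^ N := by
  have h : (augIdeal R n ^ N).map (g.1 : FA R n →ₐ[R] FA R n).toLinearMap
      = augIdeal R n ^ N := by
    rw [Submodule.map_pow]
    exact congrArg (· ^ N) g.2
  rw [← h]
  exact ⟨f, hf, rfl⟩

theorem Aut0.apply_ι_mem (g : Aut0 R n) (i : Fin n) :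
    g.1 (FreeAlgebra.ι R i) ∈ augIdeal R n := by
  have h := Aut0.apply_mem_pow g 1 (f := FreeAlgebra.ι R i)
    (by rw [pow_one]; exact ι_mem_augIdeal i)
  rwa [pow_one] at h

variable (R n)

/-- The augmentation subgroup `H_N`: all `g ∈ Aut_0` with `g(x_i) ≡ x_i` modulo `I ^ N`. -/
def augSubgroup (N : ℕ) : Subgroup (Aut0 R n) where
  carrier := {g | ∀ i, g.1 (FreeAlgebra.ι R i) - FreeAlgebra.ι R i ∈ augIdeal R n ^ N}
  one_mem' := by
    intro i
    simp
  mul_mem' := by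
    intro a b ha hb i
    have h1 := Submodule.add_mem _ (Aut0.apply_mem_pow a N (hb i)) (ha i)
    rw [map_sub, sub_add_sub_cancel] at h1
    exact h1
  inv_mem' := by
    intro a ha i
    have h1 := Submodule.neg_mem _ (Aut0.apply_mem_pow a⁻¹ N (ha i))
    rw [map_sub, neg_sub] at h1
    have h2 : (a⁻¹).1 (a.1 (FreeAlgebra.ι R i)) = FreeAlgebra.ι R i :=
      a.1.symm_apply_apply _
    rwa [h2] at h1

variable {R n}

/-- The coefficient of the word `w` in the noncommutative polynomial `f`. -/
def coeff (f : FA R n) (w : FreeMonoid (Fin n)) : R :=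
  (FreeAlgebra.equivMonoidAlgebraFreeMonoid f : MonoidAlgebra R (FreeMonoid (Fin n))).coeff w

/-- The coordinates of an automorphism `g`: the coefficients of `g(x_1), …, g(x_n)`. -/
def coord (g : Aut0 R n) (s : Fin n × FreeMonoid (Fin n)) : R :=
  coeff (g.1 (FreeAlgebra.ι R s.1)) s.2

variable (R n)

/-- The `d`-th member of the filtration of `Aut_0` by total degree: all `g` for which every
`g(x_i)` has total degree at most `d`. -/
def degLE (d : ℕ) : Set (Aut0 R n) :=
  {g | ∀ (i : Fin n) (w : FreeMonoid (Fin n)), d < w.length → coord g (i, w) = 0}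

end Algebra

section BaseChange

variable {K : Type*} [Field K] {L : Type*} [Field L] [Algebra K L] {n : ℕ}

variable (K L n) in
/-- The extension of scalars `K⟨x_1, …, x_n⟩ → L⟨x_1, …, x_n⟩`. -/
def extend : FA K n →ₐ[K] FA L n := FreeAlgebra.lift K (FreeAlgebra.ι L)

theorem extend_ι (i : Fin n) : extend K L n (FreeAlgebra.ι K i) = FreeAlgebra.ι L i := by
  simp [extend]

/-- The `L`-algebra endomorphism with `x_i ↦ g(x_i)`. -/
def extendHom (g : FA K n →ₐ[K] FA K n) : FA L n →ₐ[L] FA L n :=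
  FreeAlgebra.lift L (fun i => extend K L n (g (FreeAlgebra.ι K i)))

theorem extendHom_ι (g : FA K n →ₐ[K] FA K n) (i : Fin n) :
    extendHom (L := L) g (FreeAlgebra.ι L i) = extend K L n (g (FreeAlgebra.ι K i)) := by
  simp [extendHom]

theorem extendHom_extend (g : FA K n →ₐ[K] FA K n) (f : FA K n) :
    extendHom (L := L) g (extend K L n f) = extend K L n (g f) := by
  have h : ((extendHom (L := L) g).restrictScalars K).comp (extend K L n)
      = (extend K L n).comp g := by
    ext i
    simp [extend_ι, extendHom_ι]
  exact DFunLike.congr_fun h f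

theorem extendHom_comp (g h : FA K n →ₐ[K] FA K n) :
    (extendHom (L := L) g).comp (extendHom h) = extendHom (g.comp h) := by
  ext i
  simp [extendHom_ι, extendHom_extend]

theorem extendHom_id : extendHom (L := L) (AlgHom.id K (FA K n)) = AlgHom.id L (FA L n) := by
  ext i
  simp [extendHom_ι, extend_ι]

theorem extend_mem_augIdeal {f : FA K n} (hf : f ∈ augIdeal K n) :
    extend K L n f ∈ augIdeal L n := by
  unfold augIdeal at hf
  induction hf using Submodule.span_induction with
  | mem x hx =>
    obtain ⟨c, d, i, rfl⟩ := hx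
    rw [map_mul, map_mul, extend_ι]
    exact Submodule.subset_span ⟨_, _, i, rfl⟩
  | zero => simp
  | add x y _ _ hx hy => rw [map_add]; exact Submodule.add_mem _ hx hy
  | smul r x _ hx =>
    rw [map_smul, ← algebraMap_smul L r (extend K L n x)]
    exact Submodule.smul_mem _ _ hx

theorem extendHom_mul_inv (g : Aut0 K n) :
    (extendHom (L := L) (g.1 : FA K n →ₐ[K] FA K n)).comp
      (extendHom ((g⁻¹).1 : FA K n →ₐ[K] FA K n)) = AlgHom.id L (FA L n) := by
  rw [extendHom_comp, ← extendHom_id (K := K)]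
  congr 1
  ext i
  exact g.1.apply_symm_apply _

theorem extendHom_inv_mul (g : Aut0 K n) :
    (extendHom (L := L) ((g⁻¹).1 : FA K n →ₐ[K] FA K n)).comp
      (extendHom (g.1 : FA K n →ₐ[K] FA K n)) = AlgHom.id L (FA L n) := by
  rw [extendHom_comp, ← extendHom_id (K := K)]
  congr 1
  ext i
  exact g.1.symm_apply_apply _

theorem extendHom_mem_augIdeal (g : Aut0 K n) {f : FA L n} (hf : f ∈ augIdeal L n) :
    extendHom (g.1 : FA K n →ₐ[K] FA K n) f ∈ augIdeal L n := by
  refine apply_mem_augIdeal _ (fun i => ?_) hf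
  rw [extendHom_ι]
  exact extend_mem_augIdeal (Aut0.apply_ι_mem g i)

/-- Base change of automorphisms: the inclusion of the `K`-points
`Aut_0(K⟨x_1, …, x_n⟩)` into the `L`-points `Aut_0(L⟨x_1, …, x_n⟩)`. -/
def baseChange (g : Aut0 K n) : Aut0 L n :=
  ⟨AlgEquiv.ofAlgHom (extendHom (g.1 : FA K n →ₐ[K] FA K n))
      (extendHom ((g⁻¹).1 : FA K n →ₐ[K] FA K n))
      (extendHom_mul_inv g) (extendHom_inv_mul g), by
    apply le_antisymm
    · rintro _ ⟨f, hf, rfl⟩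
      exact extendHom_mem_augIdeal g hf
    · intro f hf
      exact ⟨extendHom ((g⁻¹).1 : FA K n →ₐ[K] FA K n) f, extendHom_mem_augIdeal g⁻¹ hf,
        DFunLike.congr_fun (extendHom_mul_inv g) f⟩⟩

end BaseChange

section Ind

variable (K : Type*) [Field K] {L : Type*} [Field L] [Algebra K L] {n : ℕ}

/-- `F` is a regular function on `X`, defined over `K`: locally for the Zariski topology of `X`
it is a quotient of two polynomials over `K` in the coordinates. -/
def IsRegularOn (X : Set (Aut0 L n)) (F : Aut0 L n → L) : Prop :=
  ∀ g ∈ X, ∃ p q : MvPolynomial (Fin n × FreeMonoid (Fin n)) K,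
    MvPolynomial.aeval (coord g) q ≠ 0 ∧
    ∀ h ∈ X, MvPolynomial.aeval (coord h) q ≠ 0 →
      F h = MvPolynomial.aeval (coord h) p / MvPolynomial.aeval (coord h) q

/-- `φ` is a morphism of ind-varieties over `K` for the filtration by total degree: each member
`degLE d` is mapped into some member `degLE e`, and the restriction of `φ` to `degLE d` is a
morphism, i.e. its coordinates are regular functions. -/
def IsIndMorphism (φ : Aut0 L n → Aut0 L n) : Prop :=
  ∀ d : ℕ, ∃ e : ℕ, Set.MapsTo φ (degLE L n d) (degLE L n e) ∧
    ∀ s, IsRegularOn K (degLE L n d) (fun g => coord (φ g) s)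

variable (n)

/-- `Aut_Ind(Aut_0(K⟨x_1, …, x_n⟩))`: the automorphisms, over `K`, of the ind-group
`Aut_0(K⟨x_1, …, x_n⟩)`. As usual for varieties over a field which need not be algebraically
closed, morphisms are maps of points over the algebraic closure that are defined over `K`;
`geom` is the map on these geometric points and `points` the map that it induces on the group
`Aut_0(K⟨x_1, …, x_n⟩)` of `K`-points (it is determined by `geom`). -/
structure IndAut where
  geom : Aut0 (AlgebraicClosure K) n ≃* Aut0 (AlgebraicClosure K) n
  geom_morphism : IsIndMorphism K geom
  geom_symm_morphism : IsIndMorphism K geom.symm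
  points : Aut0 K n ≃* Aut0 K n
  geom_baseChange : ∀ g : Aut0 K n, geom (baseChange g) = baseChange (points g)

end Ind

end FreeAut

end

/-!
Let `L` be algebraically closed, let `φ` be an automorphism of the ind-group `Aut_0`, and let `λ_t`
be the homothety `x_i ↦ t x_i`. Conjugation of `g` by `λ_t` multiplies the terms of degree `m + 1`
of `g` by `t ^ m`; hence for `g ∈ H_N` the curve `t ↦ λ_t g λ_t⁻¹`, `t ≠ 0`, extends over `t = 0`
by the identity, and it agrees with the identity modulo `t ^ (N - 1)`. Regular functions respect
both facts (`IsRegularOn.exists_polynomial_conj`), so they hold for the image of the curve under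
`φ`.

The image curve is `φ(λ_t) φ(g) φ(λ_t)⁻¹`. For `g ∈ H_2` the trace of its linear part is constant,
thus equal to `n`. So the linear parts of `φ(H_2)` form a normal subgroup of `GL_n` with constant
trace. This forces them to be scalars, and by continuity at `t = 0` they are `1`
(`map_mem_augSubgroup_two`): `φ(H_2) ⊆ H_2`, and `φ` acts on linear parts.

Homotheties are central modulo `H_2`, so `φ(λ_t)` has a scalar linear part. The scalar is a
rational character `t ^ k` of `t`, and the same holds for `φ⁻¹`, whence `k = ± 1`
(`exists_lin_map_homothety_pm_one`). Conjugation on `H_M / H_{M+1}` depends only on linear parts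
(`coord_conj_of_lin_eq_scalar`). So if `g ∈ H_N` and `φ(g) ∈ H_M` with `2 ≤ M < N`, the coordinates
of degree `M` along the image curve are `t ^ (k (M - 1))` times those of `φ(g)`; they are
divisible by `t ^ (N - 1)` near `t = 0`, so they are zero and `φ(g) ∈ H_{M+1}`
(`map_mem_augSubgroup_succ`). Induction on `M` gives `φ(g) ∈ H_N`.

The assertion on `K`-points follows by comparing coordinates under base change
(`baseChange_mem_augSubgroup_iff`).
-/

noncomputable section

namespace FreeAut

/-! ### Coefficients and powers of the augmentation ideal -/

section Coeff

variable {R : Type*} [CommRing R] {n : ℕ}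

theorem coeff_add (f g : FA R n) (w : FreeMonoid (Fin n)) :
    coeff (f + g) w = coeff f w + coeff g w := by
  simp [coeff]

theorem coeff_sub (f g : FA R n) (w : FreeMonoid (Fin n)) :
    coeff (f - g) w = coeff f w - coeff g w := by
  simp [coeff]

theorem coeff_smul (r : R) (f : FA R n) (w : FreeMonoid (Fin n)) :
    coeff (r • f) w = r * coeff f w := by
  simp [coeff]

theorem coeff_zero (w : FreeMonoid (Fin n)) : coeff (0 : FA R n) w = 0 := by
  simp [coeff]

variable (R) in
/-- The monomial `x_{i_1} ⋯ x_{i_k}` of a word `w = i_1 ⋯ i_k`. -/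
def monomial (w : FreeMonoid (Fin n)) : FA R n := FreeMonoid.lift (FreeAlgebra.ι R) w

theorem monomial_of (i : Fin n) : monomial R (FreeMonoid.of i) = FreeAlgebra.ι R i := by
  simp [monomial]

theorem equiv_monomial (w : FreeMonoid (Fin n)) :
    FreeAlgebra.equivMonoidAlgebraFreeMonoid (monomial R w) =
      MonoidAlgebra.single w (1 : R) := by
  have h : FreeAlgebra.equivMonoidAlgebraFreeMonoid.symm (MonoidAlgebra.single w (1 : R))
      = monomial R w := by
    simp [FreeAlgebra.equivMonoidAlgebraFreeMonoid, monomial]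
  rw [← h, AlgEquiv.apply_symm_apply]

theorem coeff_monomial [DecidableEq (FreeMonoid (Fin n))] (v w : FreeMonoid (Fin n)) :
    coeff (monomial R v) w = if v = w then 1 else 0 := by
  rw [coeff, equiv_monomial, MonoidAlgebra.coeff_single, Finsupp.single_apply]

theorem coeff_ι [DecidableEq (FreeMonoid (Fin n))] (i : Fin n) (w : FreeMonoid (Fin n)) :
    coeff (FreeAlgebra.ι R i) w = if FreeMonoid.of i = w then 1 else 0 := by
  rw [← monomial_of, coeff_monomial]

theorem coeff_ext {f g : FA R n} (h : ∀ w, coeff f w = coeff g w) : f = g := by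
  apply FreeAlgebra.equivMonoidAlgebraFreeMonoid.injective
  ext w
  exact h w

/-- The words that occur in `f`. -/
def words (f : FA R n) : Finset (FreeMonoid (Fin n)) :=
  (FreeAlgebra.equivMonoidAlgebraFreeMonoid f : MonoidAlgebra R (FreeMonoid (Fin n))).coeff.support

theorem mem_words {f : FA R n} {w : FreeMonoid (Fin n)} : w ∈ words f ↔ coeff f w ≠ 0 := by
  simp [words, coeff]

/-- `coeff` as a linear functional. -/
def coeffₗ (w : FreeMonoid (Fin n)) : FA R n →ₗ[R] R where
  toFun f := coeff f w
  map_add' f g := coeff_add f g w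
  map_smul' r f := coeff_smul r f w

theorem coeff_sum {ι : Type*} (s : Finset ι) (f : ι → FA R n) (w : FreeMonoid (Fin n)) :
    coeff (∑ i ∈ s, f i) w = ∑ i ∈ s, coeff (f i) w :=
  map_sum (coeffₗ w) f s

theorem sum_words (f : FA R n) : ∑ w ∈ words f, coeff f w • monomial R w = f := by
  classical
  refine coeff_ext fun v => ?_
  simp only [coeff_sum, coeff_smul, coeff_monomial, mul_ite, mul_one, mul_zero]
  rw [Finset.sum_ite_eq']
  split_ifs with h
  · rfl
  · simpa [mem_words] using Eq.symm (not_not.mp (mt mem_words.mpr h))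

theorem linearMap_ext_monomial {M : Type*} [AddCommGroup M] [Module R M]
    {f g : FA R n →ₗ[R] M} (h : ∀ w, f (monomial R w) = g (monomial R w)) : f = g := by
  ext p
  rw [← sum_words p]
  simp [h]

theorem coeff_mul_eq_zero {f g : FA R n} {k l : ℕ} (hf : ∀ w, w.length < k → coeff f w = 0)
    (hg : ∀ w, w.length < l → coeff g w = 0) (w : FreeMonoid (Fin n)) (hw : w.length < k + l) :
    coeff (f * g) w = 0 := by
  classical
  rw [← sum_words f, ← sum_words g, Finset.sum_mul_sum, coeff_sum]
  refine Finset.sum_eq_zero fun u hu => ?_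
  rw [coeff_sum]
  refine Finset.sum_eq_zero fun v hv => ?_
  have hm : monomial R u * monomial R v = monomial R (u * v) := (map_mul _ u v).symm
  rw [smul_mul_smul_comm, hm, coeff_smul, coeff_monomial, if_neg, mul_zero]
  rintro rfl
  have h1 := mt (hf u) (mem_words.mp hu)
  have h2 := mt (hg v) (mem_words.mp hv)
  rw [FreeMonoid.length_mul] at hw
  omega

theorem monomial_mem_pow (w : FreeMonoid (Fin n)) :
    monomial R w ∈ augIdeal R n ^ w.length := by
  induction w using FreeMonoid.inductionOn' with
  | one => simp [monomial]
  | of_mul i w ih =>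
    rw [FreeMonoid.length_mul, FreeMonoid.length_of, add_comm, pow_succ', monomial, map_mul,
      FreeMonoid.lift_eval_of]
    exact Submodule.mul_mem_mul (ι_mem_augIdeal i) ih

theorem augIdeal_mul_le (N : ℕ) :
    augIdeal R n * augIdeal R n ^ (N + 1) ≤ augIdeal R n ^ (N + 1) := by
  rw [pow_succ', ← mul_assoc]
  refine mul_le_mul_left ?_ _
  rw [Submodule.mul_le]
  intro a _ b hb
  simpa using mul_mem_augIdeal a 1 hb

theorem augIdeal_pow_le {M N : ℕ} (hM : 1 ≤ M) (h : M ≤ N) :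
    augIdeal R n ^ N ≤ augIdeal R n ^ M := by
  induction N, h using Nat.le_induction with
  | base => exact le_rfl
  | succ N h ih =>
    obtain ⟨k, rfl⟩ : ∃ k, N = k + 1 := ⟨N - 1, by omega⟩
    rw [pow_succ']
    exact (augIdeal_mul_le k).trans ih

/-- The powers of `I` are the degree filtration. For `N = 0` this fails, as `I ^ 0` is the span
of `1`. -/
theorem mem_augIdeal_pow_iff {N : ℕ} (hN : 1 ≤ N) {f : FA R n} :
    f ∈ augIdeal R n ^ N ↔ ∀ w, w.length < N → coeff f w = 0 := by
  classical
  constructor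
  · have base : ∀ f ∈ augIdeal R n, ∀ w, w.length < 1 → coeff f w = 0 := by
      intro f hf
      unfold augIdeal at hf
      induction hf using Submodule.span_induction with
      | mem x hx =>
        obtain ⟨a, b, i, rfl⟩ := hx
        have h1 : ∀ w : FreeMonoid (Fin n), w.length < 1 → coeff (FreeAlgebra.ι R i) w = 0 := by
          intro w hw
          rw [coeff_ι, if_neg]
          rintro rfl
          simp at hw
        exact coeff_mul_eq_zero (k := 1) (l := 0)
          (coeff_mul_eq_zero (k := 0) (l := 1) (by simp) h1) (by simp)
      | zero => intro w _; exact coeff_zero w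
      | add x y _ _ hx hy => intro w hw; rw [coeff_add, hx w hw, hy w hw, add_zero]
      | smul r x _ hx => intro w hw; rw [coeff_smul, hx w hw, mul_zero]
    induction N, hN using Nat.le_induction generalizing f with
    | base => rw [pow_one]; exact base f
    | succ N hN ih =>
      intro hf
      rw [pow_succ] at hf
      refine Submodule.mul_induction_on hf (fun a ha b hb => ?_) (fun a b ha hb w hw => ?_)
      · exact coeff_mul_eq_zero (ih ha) (base b hb)
      · rw [coeff_add, ha w hw, hb w hw, add_zero]
  · intro h
    rw [← sum_words f]
    refine Submodule.sum_mem _ fun w hw => Submodule.smul_mem _ _ ?_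
    exact augIdeal_pow_le hN (not_lt.mp (mt (h w) (mem_words.mp hw))) (monomial_mem_pow w)

theorem mem_augIdeal_pow_succ_of_coeff {M : ℕ} (hM : 1 ≤ M) {f : FA R n}
    (hf : f ∈ augIdeal R n ^ M) (h : ∀ w, w.length = M → coeff f w = 0) :
    f ∈ augIdeal R n ^ (M + 1) := by
  rw [mem_augIdeal_pow_iff (by omega)]
  intro w hw
  rcases Nat.lt_succ_iff_lt_or_eq.mp hw with h1 | h1
  · exact (mem_augIdeal_pow_iff hM).mp hf w h1
  · exact h w h1

/-- Statements about linear maps on `I` can be checked on the variables and on `I ^ 2`, since the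
variables span `I` modulo `I ^ 2`. -/
theorem apply_mem_of_ι_of_sq {A : Type*} [AddCommGroup A] [Module R A] (D : FA R n →ₗ[R] A)
    (P : Submodule R A) (h1 : ∀ i, D (FreeAlgebra.ι R i) ∈ P)
    (h2 : ∀ f ∈ augIdeal R n ^ 2, D f ∈ P) {f : FA R n} (hf : f ∈ augIdeal R n) : D f ∈ P := by
  rw [← sum_words f, map_sum]
  refine Submodule.sum_mem _ fun w hw => ?_
  rw [map_smul]
  refine Submodule.smul_mem _ _ ?_
  have h0 : 1 ≤ w.length := by
    rw [← pow_one (augIdeal R n), mem_augIdeal_pow_iff le_rfl] at hf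
    exact not_lt.mp (mt (hf w) (mem_words.mp hw))
  rcases h0.eq_or_lt with h | h
  · obtain ⟨i, rfl⟩ := FreeMonoid.length_eq_one.mp h.symm
    rw [monomial_of]
    exact h1 i
  · exact h2 _ (augIdeal_pow_le (by norm_num) h (monomial_mem_pow w))

end Coeff

/-! ### Linear parts and leading terms -/

section Lin

variable {R : Type*} [CommRing R] {n : ℕ}

theorem coord_one_of_length_ne (s : Fin n × FreeMonoid (Fin n)) (hs : s.2.length ≠ 1) :
    coord (1 : Aut0 R n) s = 0 := by
  classical
  have h : coord (1 : Aut0 R n) s = coeff (FreeAlgebra.ι R s.1) s.2 := rfl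
  rw [h, coeff_ι, if_neg]
  intro h
  rw [← h] at hs
  exact hs (FreeMonoid.length_of _)

theorem coord_of_length_zero (g : Aut0 R n) (s : Fin n × FreeMonoid (Fin n))
    (hs : s.2.length = 0) : coord g s = 0 := by
  have h := Aut0.apply_ι_mem g s.1
  rw [← pow_one (augIdeal R n), mem_augIdeal_pow_iff le_rfl] at h
  exact h _ (by omega)

theorem mem_augSubgroup_iff {N : ℕ} (hN : 1 ≤ N) {g : Aut0 R n} :
    g ∈ augSubgroup R n N ↔
      ∀ s : Fin n × FreeMonoid (Fin n), s.2.length < N → coord g s = coord 1 s := by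
  have h : g ∈ augSubgroup R n N ↔
    ∀ i, g.1 (FreeAlgebra.ι R i) - FreeAlgebra.ι R i ∈ augIdeal R n ^ N := Iff.rfl
  simp only [h, mem_augIdeal_pow_iff hN, coeff_sub, sub_eq_zero]
  exact ⟨fun h s hs => h s.1 s.2 hs, fun h i w hw => h (i, w) hw⟩

/-- An element of `H_M` whose coordinates of degree `M` vanish lies in `H_{M+1}`. -/
theorem mem_augSubgroup_succ {M : ℕ} (hM : 2 ≤ M) {g : Aut0 R n} (hg : g ∈ augSubgroup R n M)
    (h : ∀ s : Fin n × FreeMonoid (Fin n), s.2.length = M → coord g s = 0) :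
    g ∈ augSubgroup R n (M + 1) := by
  rw [mem_augSubgroup_iff (by omega)] at hg ⊢
  intro s hs
  rcases Nat.lt_succ_iff_lt_or_eq.mp hs with h1 | h1
  · exact hg s h1
  · rw [h s h1, coord_one_of_length_ne s (by omega)]

theorem exists_mem_degLE (g : Aut0 R n) : ∃ d, g ∈ degLE R n d := by
  refine ⟨Finset.univ.sup fun i => (words (g.1 (FreeAlgebra.ι R i))).sup FreeMonoid.length, ?_⟩
  intro i w hw
  by_contra h
  have h1 : w.length ≤ (words (g.1 (FreeAlgebra.ι R i))).sup FreeMonoid.length :=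
    Finset.le_sup (f := FreeMonoid.length) (mem_words.mpr h)
  have h2 := Finset.le_sup (f := fun i => (words (g.1 (FreeAlgebra.ι R i))).sup FreeMonoid.length)
    (Finset.mem_univ i)
  exact absurd (h1.trans h2) (not_le.mpr hw)

theorem coeff_of_apply (g : Aut0 R n) {f : FA R n} (hf : f ∈ augIdeal R n) (j : Fin n) :
    coeff (g.1 f) (FreeMonoid.of j) =
      ∑ k, coord g (k, FreeMonoid.of j) * coeff f (FreeMonoid.of k) := by
  classical
  let D : FA R n →ₗ[R] R := (coeffₗ (FreeMonoid.of j)).comp g.1.toLinearMap -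
    ∑ k, coord g (k, FreeMonoid.of j) • coeffₗ (FreeMonoid.of k)
  have hD : ∀ f, D f = coeff (g.1 f) (FreeMonoid.of j) -
      ∑ k, coord g (k, FreeMonoid.of j) * coeff f (FreeMonoid.of k) := by
    intro f
    simp [D, coeffₗ, LinearMap.sum_apply]
  have h := apply_mem_of_ι_of_sq D ⊥ (fun i => ?_) (fun f hf => ?_) hf
  · rwa [Submodule.mem_bot, hD, sub_eq_zero] at h
  · rw [Submodule.mem_bot, hD]
    simp [coeff_ι, FreeMonoid.of_injective.eq_iff, coord]
  · have hg := Aut0.apply_mem_pow g 2 hf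
    rw [mem_augIdeal_pow_iff (by norm_num)] at hf hg
    rw [Submodule.mem_bot, hD, hg _ (by simp), zero_sub, neg_eq_zero]
    exact Finset.sum_eq_zero fun k _ => by rw [hf _ (by simp), mul_zero]

/-- The linear part of an automorphism, i.e. the map that it induces on `I / I ^ 2`; its `i`-th
column consists of the coefficients of the linear terms of `g(x_i)`. -/
def lin : Aut0 R n →* Matrix (Fin n) (Fin n) R where
  toFun g := Matrix.of fun j i => coord g (i, FreeMonoid.of j)
  map_one' := by
    classical
    ext j i
    change coeff (FreeAlgebra.ι R i) (FreeMonoid.of j) = _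
    simp [coeff_ι, Matrix.one_apply, FreeMonoid.of_injective.eq_iff, eq_comm]
  map_mul' g h := by
    ext j i
    rw [Matrix.mul_apply]
    exact coeff_of_apply g (Aut0.apply_ι_mem h i) j

theorem lin_apply (g : Aut0 R n) (j i : Fin n) : lin g j i = coord g (i, FreeMonoid.of j) := rfl

theorem lin_inv_mul (g : Aut0 R n) : lin g⁻¹ * lin g = 1 := by
  rw [← map_mul, inv_mul_cancel, map_one]

theorem lin_mul_inv (g : Aut0 R n) : lin g * lin g⁻¹ = 1 := by
  rw [← map_mul, mul_inv_cancel, map_one]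

theorem mem_augSubgroup_two_iff {g : Aut0 R n} : g ∈ augSubgroup R n 2 ↔ lin g = 1 := by
  rw [mem_augSubgroup_iff (by norm_num)]
  constructor
  · intro h
    rw [← map_one lin]
    ext j i
    exact h (i, FreeMonoid.of j) (by simp)
  · rintro h ⟨i, w⟩ hw
    rcases Nat.lt_succ_iff_lt_or_eq.mp hw with h1 | h1
    · rw [coord_of_length_zero g _ (by simpa using h1),
        coord_of_length_zero 1 _ (by simpa using h1)]
    · obtain ⟨j, rfl⟩ := FreeMonoid.length_eq_one.mp h1
      rw [← lin_apply, ← lin_apply, h, map_one]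

/-- The linear substitution `x_i ↦ ∑ j, A j i • x_j`. -/
def linearHom (A : Matrix (Fin n) (Fin n) R) : FA R n →ₐ[R] FA R n :=
  FreeAlgebra.lift R fun i => ∑ j, A j i • FreeAlgebra.ι R j

theorem linearHom_ι (A : Matrix (Fin n) (Fin n) R) (i : Fin n) :
    linearHom A (FreeAlgebra.ι R i) = ∑ j, A j i • FreeAlgebra.ι R j := by
  simp [linearHom]

theorem linearHom_comp {A B : Matrix (Fin n) (Fin n) R} (h : A * B = 1) :
    (linearHom A).comp (linearHom B) = AlgHom.id R (FA R n) := by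
  ext i
  simp only [Function.comp_apply, AlgHom.comp_apply, linearHom_ι, map_sum, map_smul,
    Finset.smul_sum, smul_smul, AlgHom.id_apply]
  rw [Finset.sum_comm]
  have h1 : ∀ j, ∑ k, (B k i * A j k) • FreeAlgebra.ι R j
      = (if j = i then (1 : R) else 0) • FreeAlgebra.ι R j := by
    intro j
    rw [← Finset.sum_smul, ← Matrix.one_apply, ← h, Matrix.mul_apply]
    simp only [mul_comm]
  simp [h1]

theorem linearHom_mem (A : Matrix (Fin n) (Fin n) R) {f : FA R n} (hf : f ∈ augIdeal R n) :
    linearHom A f ∈ augIdeal R n := by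
  refine apply_mem_augIdeal _ (fun i => ?_) hf
  rw [linearHom_ι]
  exact Submodule.sum_mem _ fun j _ => Submodule.smul_mem _ _ (ι_mem_augIdeal j)

/-- The linear automorphism given by an invertible matrix. -/
def linearAut (A : GL (Fin n) R) : Aut0 R n :=
  ⟨AlgEquiv.ofAlgHom (linearHom A.1) (linearHom A.2) (linearHom_comp A.3) (linearHom_comp A.4), by
    apply le_antisymm
    · rintro _ ⟨f, hf, rfl⟩
      exact linearHom_mem _ hf
    · intro f hf
      exact ⟨linearHom A.2 f, linearHom_mem _ hf, DFunLike.congr_fun (linearHom_comp A.3) f⟩⟩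

theorem linearAut_ι (A : GL (Fin n) R) (i : Fin n) :
    (linearAut A).1 (FreeAlgebra.ι R i) = ∑ j, A j i • FreeAlgebra.ι R j :=
  linearHom_ι _ i

theorem lin_linearAut (A : GL (Fin n) R) : lin (linearAut A) = A := by
  classical
  ext j i
  simp [lin_apply, coord, linearAut_ι, coeff_sum, coeff_smul, coeff_ι,
    FreeMonoid.of_injective.eq_iff]

/-- The homothety `x_i ↦ t • x_i`. -/
def homothety (t : Rˣ) : Aut0 R n :=
  linearAut (Units.map (Matrix.scalar (Fin n)).toMonoidHom t)

theorem lin_homothety (t : Rˣ) :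
    lin (homothety t : Aut0 R n) = Matrix.scalar (Fin n) (t : R) :=
  lin_linearAut _

theorem homothety_ι (t : Rˣ) (i : Fin n) :
    (homothety t : Aut0 R n).1 (FreeAlgebra.ι R i) = (t : R) • FreeAlgebra.ι R i := by
  rw [homothety, linearAut_ι]
  simp [Matrix.diagonal_apply]

theorem coord_homothety (t : Rˣ) (s : Fin n × FreeMonoid (Fin n)) :
    coord (homothety t) s = t * coord 1 s := by
  rw [coord, homothety_ι, coeff_smul]
  rfl

theorem homothety_mem_degLE (t : Rˣ) : (homothety t : Aut0 R n) ∈ degLE R n 1 := by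
  intro i w hw
  rw [coord_homothety, coord_one_of_length_ne _ (by simpa using hw.ne'), mul_zero]

theorem homothety_monomial (t : Rˣ) (w : FreeMonoid (Fin n)) :
    (homothety t : Aut0 R n).1 (monomial R w) = (t : R) ^ w.length • monomial R w := by
  induction w using FreeMonoid.inductionOn' with
  | one => simp [monomial]
  | of_mul i w ih =>
    have h : monomial R (FreeMonoid.of i * w) = FreeAlgebra.ι R i * monomial R w := by
      simp [monomial]
    rw [h, map_mul, ih, homothety_ι, smul_mul_smul_comm, FreeMonoid.length_mul,
      FreeMonoid.length_of, pow_add, pow_one]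

theorem coeff_homothety (t : Rˣ) (f : FA R n) (w : FreeMonoid (Fin n)) :
    coeff ((homothety t : Aut0 R n).1 f) w = (t : R) ^ w.length * coeff f w := by
  classical
  have h : (coeffₗ w).comp (homothety t : Aut0 R n).1.toLinearMap
      = (t : R) ^ w.length • coeffₗ w := by
    refine linearMap_ext_monomial fun v => ?_
    change coeff ((homothety t : Aut0 R n).1 (monomial R v)) w
      = (t : R) ^ w.length * coeff (monomial R v) w
    rw [homothety_monomial, coeff_smul, coeff_monomial]
    split_ifs with h
    · rw [h]
    · simp
  exact DFunLike.congr_fun h f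

theorem homothety_inv_ι (t : Rˣ) (i : Fin n) :
    ((homothety t : Aut0 R n)⁻¹).1 (FreeAlgebra.ι R i) = (↑t⁻¹ : R) • FreeAlgebra.ι R i := by
  have h : (homothety t : Aut0 R n).1 ((↑t⁻¹ : R) • FreeAlgebra.ι R i) = FreeAlgebra.ι R i := by
    rw [map_smul, homothety_ι, smul_smul, Units.inv_mul, one_smul]
  conv_lhs => rw [← h]
  exact (homothety t : Aut0 R n).1.symm_apply_apply _

/-- Conjugation by the homothety of ratio `t` multiplies the terms of degree `m + 1` by `t ^ m`. -/
theorem coord_homothety_conj (t : Rˣ) (g : Aut0 R n) (s : Fin n × FreeMonoid (Fin n)) :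
    coord (homothety t * g * (homothety t)⁻¹) s = (t : R) ^ (s.2.length - 1) * coord g s := by
  have h : coord (homothety t * g * (homothety t)⁻¹) s
      = coeff ((homothety t : Aut0 R n).1 (g.1 (((homothety t : Aut0 R n)⁻¹).1
        (FreeAlgebra.ι R s.1)))) s.2 := rfl
  rw [h, homothety_inv_ι, map_smul, map_smul, coeff_smul, coeff_homothety]
  rcases Nat.eq_zero_or_pos s.2.length with h0 | h0
  · have := coord_of_length_zero g s h0
    rw [this]
    rw [coord] at this
    rw [this]
    simp
  · obtain ⟨m, hm⟩ : ∃ m, s.2.length = m + 1 := ⟨s.2.length - 1, by omega⟩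
    rw [hm, Nat.add_sub_cancel, pow_succ', mul_assoc, Units.inv_mul_cancel_left]
    rfl

/-- An automorphism whose linear part is the scalar `c` acts on `I ^ M / I ^ (M + 1)` as `c ^ M`. -/
theorem apply_sub_smul_mem (h : Aut0 R n) (c : R)
    (hc : ∀ i, h.1 (FreeAlgebra.ι R i) - c • FreeAlgebra.ι R i ∈ augIdeal R n ^ 2)
    {M : ℕ} (hM : 1 ≤ M) {f : FA R n} (hf : f ∈ augIdeal R n ^ M) :
    h.1 f - c ^ M • f ∈ augIdeal R n ^ (M + 1) := by
  have base : ∀ f ∈ augIdeal R n, h.1 f - c • f ∈ augIdeal R n ^ 2 := by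
    intro f hf
    exact apply_mem_of_ι_of_sq (h.1.toLinearMap - c • LinearMap.id) _ hc
      (fun f hf => Submodule.sub_mem _ (Aut0.apply_mem_pow h 2 hf) (Submodule.smul_mem _ _ hf)) hf
  induction M, hM using Nat.le_induction generalizing f with
  | base =>
    rw [pow_one] at hf ⊢
    exact base f hf
  | succ M hM ih =>
    rw [pow_succ] at hf
    refine Submodule.mul_induction_on hf (fun a ha b hb => ?_) (fun a b ha hb => ?_)
    · have e : h.1 (a * b) - c ^ (M + 1) • (a * b)
          = (h.1 a - c ^ M • a) * h.1 b + c ^ M • (a * (h.1 b - c • b)) := by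
        rw [map_mul, sub_mul, mul_sub, smul_sub, smul_mul_assoc, mul_smul_comm, smul_smul,
          ← pow_succ, sub_add_sub_cancel]
      rw [e]
      refine Submodule.add_mem _ ?_ (Submodule.smul_mem _ _ ?_)
      · rw [pow_succ]
        have := Aut0.apply_mem_pow h 1 (f := b) (by rwa [pow_one])
        rw [pow_one] at this
        exact Submodule.mul_mem_mul (ih ha) this
      · rw [show M + 1 + 1 = M + 2 from rfl, pow_add]
        exact Submodule.mul_mem_mul ha (base b hb)
    · have e : h.1 (a + b) - c ^ (M + 1) • (a + b)
          = (h.1 a - c ^ (M + 1) • a) + (h.1 b - c ^ (M + 1) • b) := by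
        rw [map_add, smul_add]; abel
      rw [e]
      exact Submodule.add_mem _ ha hb

theorem apply_sub_mem {M : ℕ} (hM : 1 ≤ M) {g : Aut0 R n} (hg : g ∈ augSubgroup R n M)
    (f : FA R n) : g.1 f - f ∈ augIdeal R n ^ M := by
  induction f using FreeAlgebra.induction with
  | grade0 r => simp
  | grade1 i => exact hg i
  | mul a b ha hb =>
    have e : g.1 (a * b) - a * b = (g.1 a - a) * g.1 b + a * (g.1 b - b) := by
      rw [map_mul, sub_mul, mul_sub, sub_add_sub_cancel]
    rw [e]
    rw [mem_augIdeal_pow_iff hM] at ha hb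
    refine Submodule.add_mem _ ?_ ?_ <;> rw [mem_augIdeal_pow_iff hM] <;> intro w hw
    · exact coeff_mul_eq_zero (l := 0) ha (by simp) w hw
    · exact coeff_mul_eq_zero (k := 0) (by simp) hb w (by omega)
  | add a b ha hb =>
    rw [map_add, add_sub_add_comm]
    exact Submodule.add_mem _ ha hb

theorem apply_sub_mem_of_sq {M : ℕ} (hM : 1 ≤ M) {g : Aut0 R n} (hg : g ∈ augSubgroup R n M)
    {f : FA R n} (hf : f ∈ augIdeal R n ^ 2) : g.1 f - f ∈ augIdeal R n ^ (M + 1) := by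
  rw [pow_two] at hf
  refine Submodule.mul_induction_on hf (fun a ha b hb => ?_) (fun a b ha hb => ?_)
  · have e : g.1 (a * b) - a * b = (g.1 a - a) * g.1 b + a * (g.1 b - b) := by
      rw [map_mul, sub_mul, mul_sub, sub_add_sub_cancel]
    rw [e]
    refine Submodule.add_mem _ ?_ ?_
    · rw [pow_succ]
      have := Aut0.apply_mem_pow g 1 (f := b) (by rwa [pow_one])
      rw [pow_one] at this
      exact Submodule.mul_mem_mul (apply_sub_mem hM hg a) this
    · rw [pow_succ']
      exact Submodule.mul_mem_mul ha (apply_sub_mem hM hg b)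
  · rw [map_add, add_sub_add_comm]
    exact Submodule.add_mem _ ha hb

theorem lin_eq_scalar_iff {g : Aut0 R n} {c : R} : lin g = Matrix.scalar (Fin n) c ↔
    ∀ i, g.1 (FreeAlgebra.ι R i) - c • FreeAlgebra.ι R i ∈ augIdeal R n ^ 2 := by
  classical
  have hI : ∀ i, g.1 (FreeAlgebra.ι R i) - c • FreeAlgebra.ι R i ∈ augIdeal R n ^ 1 := by
    intro i
    rw [pow_one]
    exact Submodule.sub_mem _ (Aut0.apply_ι_mem g i) (Submodule.smul_mem _ _ (ι_mem_augIdeal i))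
  have hc : ∀ i j, coeff (g.1 (FreeAlgebra.ι R i) - c • FreeAlgebra.ι R i) (FreeMonoid.of j)
      = lin g j i - Matrix.scalar (Fin n) c j i := by
    intro i j
    rw [coeff_sub, coeff_smul, coeff_ι, lin_apply, coord]
    simp [Matrix.diagonal_apply, FreeMonoid.of_injective.eq_iff, eq_comm]
  constructor
  · intro h i
    refine mem_augIdeal_pow_succ_of_coeff le_rfl (hI i) fun w hw => ?_
    obtain ⟨j, rfl⟩ := FreeMonoid.length_eq_one.mp hw
    rw [hc, h, sub_self]
  · intro h
    ext j i
    have := (mem_augIdeal_pow_iff (by norm_num)).mp (h i) (FreeMonoid.of j) (by simp)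
    rwa [hc, sub_eq_zero] at this

/-- On `H_{M+1} / H_{M+2}` conjugation by an automorphism whose linear part is the scalar `c` is
multiplication by `c ^ M`, whatever its terms of higher degree are. -/
theorem coord_conj_of_lin_eq_scalar {h g : Aut0 R n} {c : Rˣ}
    (hc : lin h = Matrix.scalar (Fin n) (c : R)) {M : ℕ} (hM : 1 ≤ M)
    (hg : g ∈ augSubgroup R n (M + 1)) (s : Fin n × FreeMonoid (Fin n))
    (hs : s.2.length = M + 1) :
    coord (h * g * h⁻¹) s = (c : R) ^ M * coord g s := by
  obtain ⟨i, w⟩ := s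
  have hc' : lin h⁻¹ = Matrix.scalar (Fin n) (↑c⁻¹ : R) := by
    have h1 := lin_inv_mul h
    rw [hc] at h1
    calc lin h⁻¹
        = lin h⁻¹ * (Matrix.scalar (Fin n) (c : R) * Matrix.scalar (Fin n) (↑c⁻¹ : R)) := by
          rw [← map_mul, Units.mul_inv, map_one, mul_one]
      _ = _ := by rw [← mul_assoc, h1, one_mul]
  -- With `y = h⁻¹ x_i = c⁻¹ x_i + z`, `z ∈ I ^ 2`, one has `h g h⁻¹ x_i - x_i = h (g y - y)`.
  set x : FA R n := FreeAlgebra.ι R i with hx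
  set y := (h⁻¹).1 x with hy
  set z := y - (↑c⁻¹ : R) • x with hz
  have hz2 : z ∈ augIdeal R n ^ 2 := lin_eq_scalar_iff.mp hc' i
  have hhy : h.1 y = x := h.1.apply_symm_apply x
  have he := apply_sub_smul_mem h c (lin_eq_scalar_iff.mp hc) (by omega)
    (apply_sub_mem (by omega) hg y)
  have hgz := apply_sub_mem_of_sq (by omega) hg hz2
  have e : h.1 (g.1 y) - x - (c : R) ^ M • (g.1 x - x)
      = (h.1 (g.1 y - y) - (c : R) ^ (M + 1) • (g.1 y - y))
        + (c : R) ^ (M + 1) • (g.1 z - z) := by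
    have hyz : y = z + (↑c⁻¹ : R) • x := by rw [hz, sub_add_cancel]
    have e1 : g.1 y - y = (g.1 z - z) + (↑c⁻¹ : R) • (g.1 x - x) := by
      rw [hyz, map_add, map_smul, smul_sub]; abel
    have e2 : (c : R) ^ (M + 1) * (↑c⁻¹ : R) = (c : R) ^ M := by
      rw [pow_succ, Units.mul_inv_cancel_right]
    rw [map_sub, hhy]
    rw [e1]
    rw [smul_add, smul_smul, e2]
    abel
  have hmem := Submodule.add_mem _ he (Submodule.smul_mem _ ((c : R) ^ (M + 1)) hgz)
  rw [← e, mem_augIdeal_pow_iff (by omega)] at hmem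
  have h1 := hmem w (by simp only at hs; omega)
  have hxw : coeff x w = 0 :=
    coord_one_of_length_ne (R := R) (i, w) (by simp only at hs ⊢; omega)
  rw [coeff_sub, coeff_smul, coeff_sub, coeff_sub, hxw, sub_zero, sub_zero, sub_eq_zero] at h1
  exact h1

end Lin

/-! ### Regular functions along curves -/

open Polynomial in
/-- A polynomial identity may be checked on the units outside the zeros of some `q ≠ 0`. -/
theorem _root_.Polynomial.eq_of_eval_eq_of_ne_zero {L : Type*} [Field L] [Infinite L]
    {p₁ p₂ q : L[X]} (hq : q ≠ 0)
    (h : ∀ t : Lˣ, q.eval (t : L) ≠ 0 → p₁.eval (t : L) = p₂.eval (t : L)) :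
    p₁ = p₂ := by
  have h0 : (p₁ - p₂) * (q * X) = 0 := by
    refine Polynomial.funext fun t => ?_
    by_cases ht : t = 0
    · simp [ht]
    by_cases hqt : q.eval t = 0
    · simp [hqt]
    · have h1 : p₁.eval t = p₂.eval t := h (Units.mk0 t ht) hqt
      rw [eval_mul, eval_sub, h1, sub_self, zero_mul, eval_zero]
  rcases mul_eq_zero.mp h0 with h1 | h1
  · exact sub_eq_zero.mp h1
  · exact absurd h1 (mul_ne_zero hq X_ne_zero)

theorem dvd_aeval_sub_aeval {σ K A : Type*} [CommRing K] [CommRing A] [Algebra K A] {a b : σ → A}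
    {D : A} (h : ∀ s, D ∣ a s - b s) (p : MvPolynomial σ K) :
    D ∣ MvPolynomial.aeval a p - MvPolynomial.aeval b p := by
  induction p using MvPolynomial.induction_on with
  | C r => simp
  | add p q hp hq =>
    rw [map_add, map_add, add_sub_add_comm]
    exact dvd_add hp hq
  | mul_X p s hp =>
    have e : MvPolynomial.aeval a (p * MvPolynomial.X s)
          - MvPolynomial.aeval b (p * MvPolynomial.X s)
        = (MvPolynomial.aeval a p - MvPolynomial.aeval b p) * a s
          + MvPolynomial.aeval b p * (a s - b s) := by
      simp only [map_mul, MvPolynomial.aeval_X]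
      ring
    rw [e]
    exact dvd_add (Dvd.dvd.mul_right hp _) (Dvd.dvd.mul_left (h s) _)

section Regular

open Polynomial

variable {K : Type*} [Field K] {L : Type*} [Field L] [Algebra K L] {n : ℕ}

theorem IsRegularOn.add {X : Set (Aut0 L n)} {F G : Aut0 L n → L} (hF : IsRegularOn K X F)
    (hG : IsRegularOn K X G) : IsRegularOn K X (fun g => F g + G g) := by
  intro g hg
  obtain ⟨p, q, hq, h⟩ := hF g hg
  obtain ⟨p', q', hq', h'⟩ := hG g hg
  refine ⟨p * q' + q * p', q * q', ?_, fun x hx hqx => ?_⟩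
  · rw [map_mul]
    exact mul_ne_zero hq hq'
  · rw [map_mul] at hqx
    obtain ⟨h1, h2⟩ := mul_ne_zero_iff.mp hqx
    simp only [h x hx h1, h' x hx h2, map_add, map_mul]
    exact div_add_div _ _ h1 h2

theorem isRegularOn_zero (X : Set (Aut0 L n)) : IsRegularOn K X (fun _ => (0 : L)) :=
  fun g _ => ⟨0, 1, by simp, fun h _ _ => by simp⟩

theorem IsRegularOn.sum {X : Set (Aut0 L n)} {ι : Type*} (s : Finset ι) {F : ι → Aut0 L n → L}
    (hF : ∀ i ∈ s, IsRegularOn K X (F i)) : IsRegularOn K X (fun g => ∑ i ∈ s, F i g) := by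
  classical
  induction s using Finset.induction_on with
  | empty => simpa using isRegularOn_zero X
  | insert a s ha ih =>
    simp only [Finset.sum_insert ha]
    exact (hF a (by simp)).add (ih fun i hi => hF i (by simp [hi]))

/-- Along a curve `γ` with polynomial coordinates `P`, a regular function is a rational function of
the parameter near a given `t₀`; if `γ` agrees with the constant curve to some order at `t₀`, so
does the regular function. -/
theorem IsRegularOn.exists_polynomial {X : Set (Aut0 L n)} {F : Aut0 L n → L}
    (hF : IsRegularOn K X F) {S : Set L} {γ : L → Aut0 L n}
    {P : Fin n × FreeMonoid (Fin n) → L[X]} (hX : ∀ t ∈ S, γ t ∈ X)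
    (hP : ∀ t ∈ S, ∀ s, (P s).eval t = coord (γ t) s) {t₀ : L} (ht₀ : t₀ ∈ S) :
    ∃ p q : L[X], q.eval t₀ ≠ 0 ∧
      (∀ t ∈ S, q.eval t ≠ 0 → F (γ t) * q.eval t = p.eval t) ∧
      ∀ D : L[X], (∀ s, D ∣ P s - C (coord (γ t₀) s)) → D ∣ p - C (F (γ t₀)) * q := by
  obtain ⟨p, q, hq, h⟩ := hF _ (hX t₀ ht₀)
  have hev : ∀ t ∈ S, ∀ r : MvPolynomial (Fin n × FreeMonoid (Fin n)) K,
      (MvPolynomial.aeval P r).eval t = MvPolynomial.aeval (coord (γ t)) r := by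
    intro t ht r
    have h1 := MvPolynomial.comp_aeval_apply P ((Polynomial.aeval (R := L) t).restrictScalars K) r
    simp only [AlgHom.restrictScalars_apply, Polynomial.coe_aeval_eq_eval] at h1
    rw [h1]
    congr 2
    funext s
    exact hP t ht s
  refine ⟨MvPolynomial.aeval P p, MvPolynomial.aeval P q, ?_, fun t ht hqt => ?_, fun D hD => ?_⟩
  · rwa [hev _ ht₀]
  · rw [hev t ht] at hqt ⊢
    rw [hev t ht, h _ (hX t ht) hqt, div_mul_cancel₀ _ hqt]
  · have hC : ∀ r : MvPolynomial (Fin n × FreeMonoid (Fin n)) K,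
        D ∣ MvPolynomial.aeval P r - C (MvPolynomial.aeval (coord (γ t₀)) r) := by
      intro r
      have h1 := MvPolynomial.comp_aeval_apply (coord (γ t₀))
        ((CAlgHom (R := L) (A := L)).restrictScalars K) r
      simp only [AlgHom.restrictScalars_apply, CAlgHom_apply] at h1
      rw [h1]
      exact dvd_aeval_sub_aeval hD r
    have e : MvPolynomial.aeval P p - C (F (γ t₀)) * MvPolynomial.aeval P q
        = (MvPolynomial.aeval P p - C (MvPolynomial.aeval (coord (γ t₀)) p))
          - C (F (γ t₀)) * (MvPolynomial.aeval P q - C (MvPolynomial.aeval (coord (γ t₀)) q)) := by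
      rw [mul_sub, ← C_mul, h _ (hX _ ht₀) hq, div_mul_cancel₀ _ hq]
      ring
    rw [e]
    exact dvd_sub (hC p) (Dvd.dvd.mul_left (hC q) _)

theorem conj_mem_degLE {d : ℕ} {g : Aut0 L n} (hg : g ∈ degLE L n d) (t : Lˣ) :
    homothety t * g * (homothety t)⁻¹ ∈ degLE L n d := by
  intro i w hw
  rw [coord_homothety_conj, hg i w hw, mul_zero]

/-- For `g ∈ H_{N+1}` the curve `t ↦ λ_t g λ_t⁻¹`, with `λ_t` the homothety of ratio `t`, extends
over `t = 0` by the identity, with contact of order `N`. -/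
theorem IsRegularOn.exists_polynomial_conj {d : ℕ} {F : Aut0 L n → L}
    (hF : IsRegularOn K (degLE L n d) F) {g : Aut0 L n} (hgd : g ∈ degLE L n d)
    {N : ℕ} (hN : 1 ≤ N) (hg : g ∈ augSubgroup L n (N + 1)) :
    ∃ p q : L[X], q.eval 0 ≠ 0 ∧
      (∀ t : Lˣ, q.eval (t : L) ≠ 0 →
        F (homothety t * g * (homothety t)⁻¹) * q.eval (t : L) = p.eval (t : L)) ∧
      X ^ N ∣ p - C (F 1) * q := by
  classical
  let γ : L → Aut0 L n := fun t =>
    if h : t = 0 then 1 else homothety (Units.mk0 t h) * g * (homothety (Units.mk0 t h))⁻¹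
  have hγ0 : γ 0 = 1 := by simp [γ]
  have hγ : ∀ t : Lˣ, γ t = homothety t * g * (homothety t)⁻¹ := by
    intro t
    simp [γ]
  let P : Fin n × FreeMonoid (Fin n) → L[X] := fun s =>
    C (coord 1 s) + C (coord g s - coord 1 s) * X ^ (s.2.length - 1)
  have h1d : (1 : Aut0 L n) ∈ degLE L n d := by
    intro i w hw
    by_cases h1 : w.length = 1
    · rw [← (mem_augSubgroup_iff (by omega)).mp hg (i, w) (by simp only; omega)]
      exact hgd i w hw
    · exact coord_one_of_length_ne _ h1
  have hcoord := (mem_augSubgroup_iff (by omega)).mp hg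
  obtain ⟨p, q, h1, h2, h3⟩ := hF.exists_polynomial (S := Set.univ) (γ := γ) (P := P) (t₀ := 0)
    (fun t _ => by
      by_cases h : t = 0
      · rwa [h, hγ0]
      · rw [← Units.val_mk0 h, hγ]
        exact conj_mem_degLE hgd _)
    (fun t _ s => by
      by_cases h : t = 0
      · rw [h, hγ0]
        simp only [P, eval_add, eval_C, eval_mul, eval_pow, eval_X]
        by_cases hs : s.2.length < N + 1
        · rw [hcoord s hs, sub_self, zero_mul, add_zero]
        · rw [zero_pow (by omega), mul_zero, add_zero]
      · obtain ⟨u, rfl⟩ : ∃ u : Lˣ, t = u := ⟨Units.mk0 t h, rfl⟩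
        rw [hγ, coord_homothety_conj]
        simp only [P, eval_add, eval_C, eval_mul, eval_pow, eval_X]
        by_cases hs : s.2.length = 1
        · rw [hs, Nat.sub_self, pow_zero, mul_one, one_mul, add_sub_cancel]
        · rw [coord_one_of_length_ne s hs, zero_add, sub_zero, mul_comm])
    (Set.mem_univ _)
  refine ⟨p, q, h1, fun t => ?_, ?_⟩
  · rw [← hγ]
    exact h2 t (Set.mem_univ _)
  · rw [← hγ0]
    refine h3 _ fun s => ?_
    simp only [P, hγ0, add_sub_cancel_left]
    by_cases hs : s.2.length < N + 1
    · simp [hcoord s hs]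
    · exact Dvd.dvd.mul_left (pow_dvd_pow _ (by omega)) _

/-- A regular function that is constant along `t ↦ λ_t g λ_t⁻¹`, `t ≠ 0`, takes the same value at
the limit point, the identity. -/
theorem IsRegularOn.apply_one_eq [Infinite L] {d : ℕ} {F : Aut0 L n → L}
    (hF : IsRegularOn K (degLE L n d) F) {g : Aut0 L n} (hgd : g ∈ degLE L n d)
    (hg : g ∈ augSubgroup L n 2) {c : L}
    (hc : ∀ t : Lˣ, F (homothety t * g * (homothety t)⁻¹) = c) : F 1 = c := by
  obtain ⟨p, q, h1, h2, h3⟩ := hF.exists_polynomial_conj hgd le_rfl hg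
  have hq : q ≠ 0 := by
    rintro rfl
    simp at h1
  have e : C c * q = p := Polynomial.eq_of_eval_eq_of_ne_zero hq fun t ht => by
    rw [← h2 t ht, hc, eval_mul, eval_C]
  rw [← e, pow_one, X_dvd_iff, coeff_zero_eq_eval_zero, ← sub_mul, ← C_sub, eval_mul, eval_C] at h3
  exact (sub_eq_zero.mp ((mul_eq_zero.mp h3).resolve_right h1)).symm

end Regular

/-! ### Multiplicative functions and invertible matrices -/

section Aux

open Polynomial

variable {L : Type*} [Field L]

theorem exists_eq_C_mul_X_pow [IsAlgClosed L] {p : L[X]} (hp : p ≠ 0)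
    (h : ∀ z : Lˣ, p.eval (z : L) ≠ 0) : ∃ (a : L) (i : ℕ), a ≠ 0 ∧ p = C a * X ^ i := by
  obtain ⟨r, hr, hr0⟩ := exists_eq_pow_rootMultiplicity_mul_and_not_dvd p hp 0
  rw [C_0, sub_zero] at hr hr0
  have hdeg : r.degree = 0 := by
    by_contra hd
    obtain ⟨z, hz⟩ := IsAlgClosed.exists_root r hd
    by_cases hz0 : z = 0
    · rw [hz0] at hz
      exact hr0 (X_dvd_iff.mpr (by rwa [coeff_zero_eq_eval_zero]))
    · refine h (Units.mk0 z hz0) ?_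
      rw [hr, Units.val_mk0, eval_mul, hz.eq_zero, mul_zero]
  rw [eq_C_of_degree_eq_zero hdeg] at hr
  refine ⟨r.coeff 0, _, ?_, by rw [mul_comm]; exact hr⟩
  intro h0
  rw [h0, C_0, mul_zero] at hr
  exact hp hr

theorem exists_isCoprime_mul (p q : L[X]) :
    ∃ p' q' d : L[X], IsCoprime p' q' ∧ p = d * p' ∧ q = d * q' := by
  classical
  let _ : GCDMonoid L[X] := EuclideanDomain.gcdMonoid L[X]
  obtain ⟨p', q', hp, hq, hu⟩ := extract_gcd p q
  exact ⟨p', q', _, (gcd_isUnit_iff _ _).mp hu, hp, hq⟩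

/-- A multiplicative function that is generically rational is a power: the nonzero zeros and poles
of the rational function are stable under all homotheties, so there are none. -/
theorem exists_zpow_of_rational [IsAlgClosed L] (χ : Lˣ →* L) {p q : L[X]} (hq : q ≠ 0)
    (h : ∀ t : Lˣ, q.eval (t : L) ≠ 0 → χ t * q.eval (t : L) = p.eval (t : L)) :
    ∃ k : ℤ, ∀ t : Lˣ, χ t = ((t ^ k : Lˣ) : L) := by
  have hχ : ∀ t, χ t ≠ 0 := fun t => (IsUnit.map χ (Group.isUnit t)).ne_zero
  -- Cancel the common factor of numerator and denominator.
  obtain ⟨p', q', d, hcop, rfl, rfl⟩ := exists_isCoprime_mul p q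
  have hq' : q' ≠ 0 := right_ne_zero_of_mul hq
  have h' : ∀ t : Lˣ, (d * q').eval (t : L) ≠ 0 → χ t * q'.eval (t : L) = p'.eval (t : L) := by
    intro t ht
    have h1 := h t ht
    rw [eval_mul] at ht
    rw [eval_mul, eval_mul] at h1
    refine mul_left_cancel₀ (left_ne_zero_of_mul ht) ?_
    rw [← h1]
    ring
  have hcomp : ∀ (s : Lˣ) {r : L[X]}, r ≠ 0 → r.comp (C (s : L) * X) ≠ 0 := by
    intro s r hr h0
    refine hr (Polynomial.funext fun z => ?_)
    have h1 := congrArg (eval ((↑s⁻¹ : L) * z)) h0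
    rwa [eval_comp, eval_mul, eval_C, eval_X, Units.mul_inv_cancel_left, eval_zero,
      ← eval_zero (x := z)] at h1
  have key : ∀ s : Lˣ, p'.comp (C (s : L) * X) * q' = C (χ s) * p' * q'.comp (C (s : L) * X) := by
    intro s
    refine Polynomial.eq_of_eval_eq_of_ne_zero (mul_ne_zero hq (hcomp s hq)) fun t ht => ?_
    rw [eval_mul, eval_comp] at ht
    obtain ⟨h1, h2⟩ := mul_ne_zero_iff.mp ht
    simp only [eval_mul, eval_C, eval_X] at h2
    have h3 := h' t h1
    have h4 := h' (s * t) (by rw [eval_mul, Units.val_mul]; exact h2)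
    rw [map_mul, Units.val_mul] at h4
    simp only [eval_mul, eval_comp, eval_C, eval_X]
    rw [← h3, ← h4]
    ring
  have key' : ∀ s z : Lˣ, p'.eval ((s : L) * z) * q'.eval (z : L)
      = χ s * p'.eval (z : L) * q'.eval ((s : L) * z) := by
    intro s z
    simpa only [eval_mul, eval_comp, eval_C, eval_X] using congrArg (eval (z : L)) (key s)
  have hp' : p' ≠ 0 := by
    rintro rfl
    have h0 : q' = 0 := Polynomial.eq_of_eval_eq_of_ne_zero hq fun t ht => by
      have := h' t ht
      rw [eval_zero] at this ⊢
      exact (mul_eq_zero.mp this).resolve_left (hχ t)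
    exact hq' h0
  have hne : ∀ z : L, p'.eval z = 0 → q'.eval z ≠ 0 := by
    intro z hz hz'
    obtain ⟨a, b, hab⟩ := hcop
    have := congrArg (eval z) hab
    rw [eval_add, eval_mul, eval_mul, hz, hz', mul_zero, mul_zero, add_zero, eval_one] at this
    exact zero_ne_one this
  -- The set of nonzero roots is stable under all homotheties.
  have hroot : ∀ {r : L[X]} (z : Lˣ), (∀ s : Lˣ, r.eval ((s : L) * z) = 0) → r = 0 := by
    intro r z hr
    refine Polynomial.eq_of_eval_eq_of_ne_zero (one_ne_zero) fun t _ => ?_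
    have := hr (t * z⁻¹)
    rwa [Units.val_mul, Units.inv_mul_cancel_right, ← eval_zero (x := (t : L))] at this
  obtain ⟨a, i, ha, rfl⟩ := exists_eq_C_mul_X_pow hp' fun z hz => hp' (hroot z fun s => by
    have h1 := key' s z
    rw [hz, mul_zero, zero_mul] at h1
    exact (mul_eq_zero.mp h1).resolve_right (hne _ hz))
  obtain ⟨b, j, hb, rfl⟩ := exists_eq_C_mul_X_pow hq' fun z hz => hq' (hroot z fun s => by
    have h1 := key' s z
    rw [hz, mul_zero] at h1
    exact (mul_eq_zero.mp h1.symm).resolve_left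
      (mul_ne_zero (hχ s) fun h0 => hne _ h0 hz))
  -- Evaluating the functional equation at `z = 1` eliminates the leading coefficients `a` and `b`.
  refine ⟨i - j, fun t => ?_⟩
  have h1 := key' t 1
  simp only [eval_mul, eval_C, eval_pow, eval_X, Units.val_one, mul_one, one_pow] at h1
  have h2 : (t : L) ^ i = χ t * (t : L) ^ j :=
    mul_left_cancel₀ (mul_ne_zero ha hb) (by linear_combination h1)
  rw [zpow_sub, zpow_natCast, zpow_natCast, Units.val_mul, Units.val_pow_eq_pow_val, h2,
    ← Units.val_pow_eq_pow_val, Units.mul_inv_cancel_right]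

theorem eq_zero_of_forall_zpow_eq_one [Infinite L] {m : ℤ} (h : ∀ t : Lˣ, t ^ m = 1) : m = 0 := by
  by_contra hm
  have hn : m.natAbs ≠ 0 := by simpa using hm
  have h1 : ∀ t : Lˣ, t ^ m.natAbs = 1 := fun t => by
    rcases Int.natAbs_eq m with h2 | h2
    · rw [← zpow_natCast, ← h2, h]
    · have := h t
      rwa [h2, zpow_neg, inv_eq_one, zpow_natCast] at this
  have h2 : (X ^ m.natAbs : L[X]) = 1 :=
    Polynomial.eq_of_eval_eq_of_ne_zero one_ne_zero fun t _ => by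
      rw [eval_pow, eval_X, eval_one, ← Units.val_pow_eq_pow_val, h1, Units.val_one]
  have h3 := congrArg (eval 0) h2
  rw [eval_pow, eval_X, zero_pow hn, eval_one] at h3
  exact zero_ne_one h3

variable {n : ℕ}

/-- The elementary matrix `1 + E_ij`, `i ≠ j`. -/
def elementary (i j : Fin n) (h : i ≠ j) : GL (Fin n) L where
  val := 1 + Matrix.single i j 1
  inv := 1 - Matrix.single i j 1
  val_inv := by
    have : Matrix.single i j (1 : L) * Matrix.single i j 1 = 0 :=
      Matrix.single_mul_single_of_ne 1 i j i h.symm 1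
    rw [mul_sub, add_mul, add_mul, this]
    simp
  inv_val := by
    have : Matrix.single i j (1 : L) * Matrix.single i j 1 = 0 :=
      Matrix.single_mul_single_of_ne 1 i j i h.symm 1
    rw [mul_add, sub_mul, sub_mul, this]
    simp

/-- For `A = 1 + E` with `E = E_ij` the trace is `tr (v ^ 2) - tr (v E v E)`, and the second term is
the square of the entry `v j i`. -/
theorem apply_eq_zero_of_trace_conj {v : Matrix (Fin n) (Fin n) L}
    (h : ∀ A : GL (Fin n) L, (v * A.1 * v * A.2).trace = 0) {i j : Fin n} (hij : i ≠ j) :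
    v j i = 0 := by
  have h1 := h 1
  have h2 := h (elementary i j hij)
  set E : Matrix (Fin n) (Fin n) L := Matrix.single i j 1 with hE
  change (v * (1 + E) * v * (1 - E)).trace = 0 at h2
  change (v * 1 * v * 1).trace = 0 at h1
  have e : v * (1 + E) * v * (1 - E)
      = v * 1 * v * 1 + (v * E * v - v * v * E) - v * (E * v * E) := by
    noncomm_ring
  have e2 : (v * E * v).trace = (v * v * E).trace := by
    rw [Matrix.trace_mul_comm, mul_assoc]
  have e3 : E * v * E = v j i • E := by
    rw [hE, Matrix.single_mul_mul_single, Matrix.smul_single]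
    simp
  rw [e, Matrix.trace_sub, Matrix.trace_add, Matrix.trace_sub, h1, e2, sub_self, e3,
    Matrix.mul_smul, Matrix.trace_smul, hE, Matrix.trace_mul_single] at h2
  simpa using h2

/-- A matrix `v` with `tr (v A v A⁻¹) = 0` for all invertible `A` is scalar: testing `A = 1 + E_ij`
shows that `v`, and with it every conjugate of `v`, is diagonal. -/
theorem exists_eq_scalar_of_trace_conj {v : Matrix (Fin n) (Fin n) L}
    (h : ∀ A : GL (Fin n) L, (v * A.1 * v * A.2).trace = 0) :
    ∃ c : L, v = Matrix.scalar (Fin n) c := by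
  have hconj : ∀ A : GL (Fin n) L, ∀ i j, i ≠ j → (A.1 * v * A.2) j i = 0 := by
    intro A i j hij
    refine apply_eq_zero_of_trace_conj (fun B => ?_) hij
    have h1 := h (A⁻¹ * B * A)
    have e1 : (A⁻¹ * B * A).1 = A.2 * B.1 * A.1 := rfl
    have e2 : (A⁻¹ * B * A).2 = A.2 * (B.2 * A.1) := rfl
    rw [e1, e2] at h1
    have e : A.1 * v * A.2 * B.1 * (A.1 * v * A.2) * B.2
        = A.1 * (v * A.2 * B.1 * A.1 * v * A.2 * B.2) := by noncomm_ring
    rw [e, Matrix.trace_mul_comm]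
    rw [← h1]
    congr 1
    noncomm_ring
  have hdiag : ∀ i j, i ≠ j → v i i = v j j := by
    intro i j hij
    have h1 := hconj (elementary i j hij) j i hij.symm
    have h2 : v j i = 0 := apply_eq_zero_of_trace_conj h hij
    have h3 : v i j = 0 := apply_eq_zero_of_trace_conj h hij.symm
    change ((1 + Matrix.single i j (1 : L)) * v * (1 - Matrix.single i j (1 : L))) i j = 0 at h1
    have e : (1 + Matrix.single i j (1 : L)) * v * (1 - Matrix.single i j (1 : L))
        = v + Matrix.single i j 1 * v - v * Matrix.single i j 1
          - Matrix.single i j 1 * v * Matrix.single i j 1 := by noncomm_ring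
    rw [e, Matrix.single_mul_mul_single] at h1
    simp [h2, h3] at h1
    linear_combination -h1
  rcases isEmpty_or_nonempty (Fin n) with hn | ⟨⟨i₀⟩⟩
  · exact ⟨0, Subsingleton.elim _ _⟩
  · refine ⟨v i₀ i₀, ?_⟩
    ext i j
    rw [Matrix.scalar_apply, Matrix.diagonal_apply]
    split_ifs with hij
    · subst hij
      by_cases h0 : i = i₀
      · rw [h0]
      · exact hdiag _ _ h0
    · exact apply_eq_zero_of_trace_conj h (Ne.symm hij)

theorem exists_eq_scalar_of_commute {v : Matrix (Fin n) (Fin n) L}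
    (h : ∀ A : GL (Fin n) L, Commute A.1 v) : ∃ c : L, v = Matrix.scalar (Fin n) c := by
  obtain ⟨c, hc⟩ := Matrix.mem_range_scalar_of_commute_single (M := v) fun i j hij => by
    have h1 := (h (elementary i j hij)).sub_left (Commute.one_left v)
    rwa [show (elementary i j hij).1 - 1 = Matrix.single i j (1 : L) from
      add_sub_cancel_left _ _] at h1
  exact ⟨c, hc.symm⟩

end Aux

/-! ### Automorphisms of the ind-group -/

section Main

open Polynomial

variable {K : Type*} [Field K] {L : Type*} [Field L] [Algebra K L] {n : ℕ}
  {φ : Aut0 L n ≃* Aut0 L n}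

theorem lin_conj_eq_scalar {g : Aut0 L n} {c : L} (hg : lin g = Matrix.scalar (Fin n) c)
    (h : Aut0 L n) : lin (h * g * h⁻¹) = Matrix.scalar (Fin n) c := by
  have h1 : lin h * Matrix.scalar (Fin n) c = Matrix.scalar (Fin n) c * lin h :=
    (Matrix.scalar_commute _ (fun r => Commute.all _ r) _).eq.symm
  rw [map_mul, map_mul, hg, h1, mul_assoc, lin_mul_inv, mul_one]

theorem trace_lin_conj (g h : Aut0 L n) : (lin (h * g * h⁻¹)).trace = (lin g).trace := by
  rw [map_mul, map_mul, Matrix.trace_mul_comm, ← mul_assoc, lin_inv_mul, one_mul]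

theorem map_conj (h g : Aut0 L n) : φ (h * g * h⁻¹) = φ h * φ g * (φ h)⁻¹ := by
  rw [map_mul, map_mul, map_inv]

instance augSubgroup_two_normal : (augSubgroup L n 2).Normal where
  conj_mem g hg h := by
    rw [mem_augSubgroup_two_iff] at hg ⊢
    rw [map_mul, map_mul, hg, mul_one, lin_mul_inv]

/-- The trace of the linear part of `φ(λ_t g λ_t⁻¹)` does not depend on `t ≠ 0`, and at the limit
point it is the trace of the identity. -/
theorem trace_lin_map [Infinite L] (hφ : IsIndMorphism K φ) {g : Aut0 L n}
    (hg : g ∈ augSubgroup L n 2) : (lin (φ g)).trace = n := by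
  obtain ⟨d, hd⟩ := exists_mem_degLE g
  obtain ⟨_, _, hreg⟩ := hφ d
  have hF : IsRegularOn K (degLE L n d) (fun g => (lin (φ g)).trace) :=
    IsRegularOn.sum Finset.univ fun i _ => hreg (i, FreeMonoid.of i)
  have h := hF.apply_one_eq hd hg (c := (lin (φ g)).trace) fun t => by
    rw [map_conj, trace_lin_conj]
  rw [← h, map_one, map_one, Matrix.trace_one, Fintype.card_fin]

/-- `φ(H_2) ⊆ H_2`: the linear parts of `φ(H_2)` form a normal subgroup of `GL_n` on which the trace
is constant, so they are scalars, and a scalar that is the linear part of `φ(g)` equals `1` because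
`λ_t g λ_t⁻¹` tends to the identity. -/
theorem map_mem_augSubgroup_two [Infinite L] (hφ : IsIndMorphism K φ) {g : Aut0 L n}
    (hg : g ∈ augSubgroup L n 2) : φ g ∈ augSubgroup L n 2 := by
  obtain ⟨c, hc⟩ : ∃ c, lin (φ g) - 1 = Matrix.scalar (Fin n) c := by
    refine exists_eq_scalar_of_trace_conj fun A => ?_
    obtain ⟨h, hh⟩ := φ.surjective (linearAut A)
    have hA : lin (φ h) = A.1 := by rw [hh, lin_linearAut]
    have hA' : lin (φ h)⁻¹ = A.2 := by
      have h1 := lin_inv_mul (φ h)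
      rw [hA] at h1
      exact left_inv_eq_right_inv h1 A.3
    have hconj : h * g * h⁻¹ ∈ augSubgroup L n 2 :=
      Subgroup.Normal.conj_mem inferInstance g hg h
    have h1 := trace_lin_map hφ (mul_mem hg hconj)
    have h2 := trace_lin_map hφ hconj
    have h3 := trace_lin_map hφ hg
    rw [map_mul, map_mul, map_conj, map_mul, map_mul, hA, hA'] at h1
    rw [map_conj, map_mul, map_mul, hA, hA'] at h2
    have e : (lin (φ g) - 1) * A.1 * (lin (φ g) - 1) * A.2
        = lin (φ g) * (A.1 * lin (φ g) * A.2) - lin (φ g) * (A.1 * A.2)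
          - A.1 * lin (φ g) * A.2 + A.1 * A.2 := by noncomm_ring
    rw [e, Matrix.trace_add, Matrix.trace_sub, Matrix.trace_sub, A.3, mul_one, h1, h2, h3,
      Matrix.trace_one, Fintype.card_fin]
    ring
  have hc' : lin (φ g) = Matrix.scalar (Fin n) (1 + c) := by
    rw [map_add, map_one, ← hc, add_sub_cancel]
  obtain ⟨d, hd⟩ := exists_mem_degLE g
  obtain ⟨_, _, hreg⟩ := hφ d
  rw [mem_augSubgroup_two_iff, hc']
  rcases isEmpty_or_nonempty (Fin n) with hn | ⟨⟨i⟩⟩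
  · exact Subsingleton.elim _ _
  have h := (hreg (i, FreeMonoid.of i)).apply_one_eq hd hg (c := 1 + c) fun t => by
    rw [map_conj, ← lin_apply, lin_conj_eq_scalar hc', Matrix.scalar_apply,
      Matrix.diagonal_apply_eq]
  rw [← h, map_one, ← lin_apply, map_one, Matrix.one_apply_eq, map_one]

/-- `φ` induces a map on linear parts. -/
theorem lin_map_congr [Infinite L] (hφ : IsIndMorphism K φ) {g h : Aut0 L n}
    (hgh : lin g = lin h) : lin (φ g) = lin (φ h) := by
  have h1 : g * h⁻¹ ∈ augSubgroup L n 2 := by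
    rw [mem_augSubgroup_two_iff, map_mul, hgh, lin_mul_inv]
  have h2 := mem_augSubgroup_two_iff.mp (map_mem_augSubgroup_two hφ h1)
  rw [map_mul, map_inv, map_mul] at h2
  calc lin (φ g) = lin (φ g) * lin (φ h)⁻¹ * lin (φ h) := by rw [mul_assoc, lin_inv_mul, mul_one]
    _ = lin (φ h) := by rw [h2, one_mul]

/-- The homotheties are central modulo `H_2`, so the linear part of `φ(λ_t)` is a scalar, and this
scalar is a rational character of `t`. -/
theorem exists_lin_map_homothety [IsAlgClosed L] (hφ : IsIndMorphism K φ) :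
    ∃ k : ℤ, ∀ t : Lˣ,
      lin (φ (homothety t)) = Matrix.scalar (Fin n) (((t ^ k : Lˣ) : L)) := by
  have : Infinite L := IsAlgClosed.instInfinite
  have hsc : ∀ t : Lˣ, ∃ c : L, lin (φ (homothety t)) = Matrix.scalar (Fin n) c := by
    intro t
    refine exists_eq_scalar_of_commute fun A => ?_
    obtain ⟨h, hh⟩ := φ.surjective (linearAut A)
    have h1 : lin (h * homothety t) = lin (homothety t * h) := by
      rw [map_mul, map_mul, lin_homothety]
      exact (Matrix.scalar_commute _ (fun r => Commute.all _ r) _).eq.symm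
    have h2 := lin_map_congr hφ h1
    rwa [map_mul, map_mul, map_mul, map_mul, hh, lin_linearAut] at h2
  classical
  choose χ hχ using hsc
  rcases isEmpty_or_nonempty (Fin n) with hn | ⟨⟨i⟩⟩
  · exact ⟨0, fun t => Subsingleton.elim _ _⟩
  have hχi : ∀ t, coord (φ (homothety t)) (i, FreeMonoid.of i) = χ t := by
    intro t
    rw [← lin_apply, hχ, Matrix.scalar_apply, Matrix.diagonal_apply_eq]
  let χ' : Lˣ →* L :=
    { toFun := χ
      map_one' := by
        have h1 : lin (homothety (1 : Lˣ) : Aut0 L n) = lin 1 := by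
          rw [lin_homothety, Units.val_one, map_one, map_one]
        rw [← hχi, ← lin_apply, lin_map_congr hφ h1, map_one, map_one, Matrix.one_apply_eq]
      map_mul' := fun s t => by
        have h1 : lin (homothety (s * t) : Aut0 L n) = lin (homothety s * homothety t) := by
          rw [map_mul, lin_homothety, lin_homothety, lin_homothety, Units.val_mul, map_mul]
        rw [← hχi, ← lin_apply, lin_map_congr hφ h1, map_mul, map_mul, hχ, hχ, ← map_mul,
          Matrix.scalar_apply, Matrix.diagonal_apply_eq] }
  obtain ⟨_, _, hreg⟩ := hφ 1
  let γ : L → Aut0 L n := fun t => if h : t = 0 then 1 else homothety (Units.mk0 t h)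
  have hγ : ∀ t : Lˣ, γ t = homothety t := by
    intro t
    simp [γ]
  obtain ⟨p, q, h1, h2, -⟩ := (hreg (i, FreeMonoid.of i)).exists_polynomial
    (S := {t | t ≠ 0}) (γ := γ) (P := fun s => C (coord 1 s) * X) (t₀ := 1)
    (fun t ht => by
      lift t to Lˣ using IsUnit.mk0 t ht
      rw [hγ]
      exact homothety_mem_degLE t)
    (fun t ht s => by
      lift t to Lˣ using IsUnit.mk0 t ht
      rw [hγ, coord_homothety, eval_mul, eval_C, eval_X, mul_comm])
    one_ne_zero
  obtain ⟨k, hk⟩ := exists_zpow_of_rational χ' (p := p) (q := q)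
    (by rintro rfl; simp at h1)
    (fun t ht => by
      have := h2 t t.ne_zero ht
      rwa [hγ, hχi] at this)
  exact ⟨k, fun t => by rw [hχ, ← hk]; rfl⟩

/-- The exponent of the character of `φ` on homotheties is invertible, since `φ⁻¹` has one too. -/
theorem exists_lin_map_homothety_pm_one [IsAlgClosed L] [Nonempty (Fin n)]
    (hφ : IsIndMorphism K φ) (hφ' : IsIndMorphism K φ.symm) :
    ∃ k : ℤ, (k = 1 ∨ k = -1) ∧ ∀ t : Lˣ,
      lin (φ (homothety t)) = Matrix.scalar (Fin n) (((t ^ k : Lˣ) : L)) := by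
  have : Infinite L := IsAlgClosed.instInfinite
  obtain ⟨k, hk⟩ := exists_lin_map_homothety hφ
  obtain ⟨l, hl⟩ := exists_lin_map_homothety hφ'
  refine ⟨k, Int.eq_one_or_neg_one_of_mul_eq_one (v := l) (sub_eq_zero.mp ?_), hk⟩
  refine eq_zero_of_forall_zpow_eq_one (L := L) fun t => ?_
  have h1 : lin (φ (homothety t)) = lin (homothety (t ^ k)) := by rw [hk, lin_homothety]
  have h2 := lin_map_congr hφ' h1
  rw [MulEquiv.symm_apply_apply, hl, lin_homothety] at h2
  have h3 : t = (t ^ k) ^ l := Units.ext (Matrix.scalar_inj.mp h2)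
  rw [zpow_sub_one, zpow_mul, ← h3, mul_inv_cancel]

/-- One step up the filtration. The coordinates of degree `M + 1` of `φ(λ_t g λ_t⁻¹)` are those of
`φ(g)` times `t ^ (± M)`, and they vanish to order at least `N > M` at `t = 0`. -/
theorem map_mem_augSubgroup_succ [IsAlgClosed L] (hφ : IsIndMorphism K φ)
    (hφ' : IsIndMorphism K φ.symm) {N M : ℕ} (hM : 1 ≤ M) (hMN : M < N) {g : Aut0 L n}
    (hg : g ∈ augSubgroup L n (N + 1)) (hφg : φ g ∈ augSubgroup L n (M + 1)) :
    φ g ∈ augSubgroup L n (M + 1 + 1) := by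
  have : Infinite L := IsAlgClosed.instInfinite
  refine mem_augSubgroup_succ (by omega) hφg fun s hs => ?_
  by_contra hc
  have : Nonempty (Fin n) := ⟨s.1⟩
  obtain ⟨k, hk, hlin⟩ := exists_lin_map_homothety_pm_one hφ hφ'
  obtain ⟨d, hd⟩ := exists_mem_degLE g
  obtain ⟨_, _, hreg⟩ := hφ d
  obtain ⟨p, q, hq0, hpq, hdvd⟩ := (hreg s).exists_polynomial_conj hd (by omega) hg
  have hq : q ≠ 0 := by
    rintro rfl
    simp at hq0
  rw [map_one, coord_one_of_length_ne s (by omega), C_0, zero_mul, sub_zero] at hdvd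
  have hpq' : ∀ t : Lˣ, q.eval (t : L) ≠ 0 →
      ((t ^ k : Lˣ) : L) ^ M * coord (φ g) s * q.eval (t : L) = p.eval (t : L) := by
    intro t ht
    rw [← hpq t ht, map_conj, coord_conj_of_lin_eq_scalar (hlin t) hM hφg s hs]
  -- For `k = -1` the function would have a pole at `t = 0`.
  rcases hk with rfl | rfl
  · have e : X ^ M * (C (coord (φ g) s) * q) = p :=
      Polynomial.eq_of_eval_eq_of_ne_zero hq fun t ht => by
        rw [← hpq' t ht, zpow_one, eval_mul, eval_mul, eval_pow, eval_X, eval_C, mul_assoc]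
    rw [← e] at hdvd
    have h1 : X ^ M * X ∣ X ^ M * (C (coord (φ g) s) * q) := by
      rw [← pow_succ]
      exact (pow_dvd_pow X hMN).trans hdvd
    have h2 := (mul_dvd_mul_iff_left (pow_ne_zero M X_ne_zero)).mp h1
    rw [X_dvd_iff, coeff_zero_eq_eval_zero, eval_mul, eval_C] at h2
    exact (mul_ne_zero hc hq0) h2
  · have e : C (coord (φ g) s) * q = X ^ M * p :=
      Polynomial.eq_of_eval_eq_of_ne_zero hq fun t ht => by
        rw [eval_mul, eval_mul, eval_pow, eval_X, eval_C, ← hpq' t ht, zpow_neg_one, mul_assoc,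
          ← mul_assoc, ← mul_pow, Units.mul_inv, one_pow, one_mul]
    have h2 := congrArg (eval 0) e
    rw [eval_mul, eval_C, eval_mul, eval_pow, eval_X, zero_pow (by omega), zero_mul] at h2
    exact (mul_ne_zero hc hq0) h2

theorem map_mem_augSubgroup [IsAlgClosed L] (hφ : IsIndMorphism K φ)
    (hφ' : IsIndMorphism K φ.symm) {N : ℕ} (hN : 1 ≤ N) {g : Aut0 L n}
    (hg : g ∈ augSubgroup L n (N + 1)) : φ g ∈ augSubgroup L n (N + 1) := by
  have : Infinite L := IsAlgClosed.instInfinite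
  have key : ∀ M, 1 ≤ M → M ≤ N → φ g ∈ augSubgroup L n (M + 1) := by
    intro M hM
    induction M, hM using Nat.le_induction with
    | base =>
      intro _
      refine map_mem_augSubgroup_two hφ fun i => ?_
      exact augIdeal_pow_le (by norm_num) (by omega) (hg i)
    | succ M hM ih =>
      intro h
      exact map_mem_augSubgroup_succ hφ hφ' hM (by omega) hg (ih (by omega))
  exact key N hN le_rfl

end Main

/-! ### Points over the base field -/

section Points

variable {K : Type*} [Field K] {L : Type*} [Field L] [Algebra K L] {n : ℕ}

theorem coeff_extend (f : FA K n) (w : FreeMonoid (Fin n)) :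
    coeff (extend K L n f) w = algebraMap K L (coeff f w) := by
  classical
  have hmon : ∀ v, extend K L n (monomial K v) = monomial L v := by
    intro v
    induction v using FreeMonoid.inductionOn' with
    | one => simp [monomial]
    | of_mul i v ih =>
      simp only [monomial, map_mul, FreeMonoid.lift_eval_of, extend_ι] at ih ⊢
      rw [ih]
  have h : ((coeffₗ w).restrictScalars K).comp (extend K L n).toLinearMap
      = (Algebra.linearMap K L).comp (coeffₗ w) := by
    refine linearMap_ext_monomial fun v => ?_
    change coeff (extend K L n (monomial K v)) w = algebraMap K L (coeff (monomial K v) w)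
    rw [hmon, coeff_monomial, coeff_monomial]
    split_ifs <;> simp
  exact DFunLike.congr_fun h f

theorem coord_baseChange (g : Aut0 K n) (s : Fin n × FreeMonoid (Fin n)) :
    coord (baseChange g : Aut0 L n) s = algebraMap K L (coord g s) := by
  have h : (baseChange g : Aut0 L n).1 (FreeAlgebra.ι L s.1)
      = extend K L n (g.1 (FreeAlgebra.ι K s.1)) := extendHom_ι _ _
  rw [coord, h, coeff_extend]
  rfl

theorem baseChange_mem_augSubgroup_iff {N : ℕ} (hN : 1 ≤ N) {g : Aut0 K n} :
    (baseChange g : Aut0 L n) ∈ augSubgroup L n N ↔ g ∈ augSubgroup K n N := by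
  have h1 : ∀ s, coord (1 : Aut0 L n) s = algebraMap K L (coord (1 : Aut0 K n) s) := by
    intro s
    have h : coord (1 : Aut0 K n) s = coeff (FreeAlgebra.ι K s.1) s.2 := rfl
    rw [h, ← coeff_extend, extend_ι]
    rfl
  simp only [mem_augSubgroup_iff hN, coord_baseChange, h1, (algebraMap K L).injective.eq_iff]

end Points

end FreeAut

end

theorem mainTheorem10 {K : Type*} [Field K] (n : ℕ) (φ : FreeAut.IndAut K n)
    (N : ℕ) (hN : 1 < N) :
    (∀ g ∈ FreeAut.augSubgroup K n N, φ.points g ∈ FreeAut.augSubgroup K n N) ∧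
    (∀ g ∈ FreeAut.augSubgroup (AlgebraicClosure K) n N,
      φ.geom g ∈ FreeAut.augSubgroup (AlgebraicClosure K) n N) := by
  obtain ⟨m, rfl⟩ : ∃ m, N = m + 1 := ⟨N - 1, by omega⟩
  have hgeom : ∀ g ∈ FreeAut.augSubgroup (AlgebraicClosure K) n (m + 1),
      φ.geom g ∈ FreeAut.augSubgroup (AlgebraicClosure K) n (m + 1) := fun g hg =>
    FreeAut.map_mem_augSubgroup φ.geom_morphism φ.geom_symm_morphism (by omega) hg
  refine ⟨fun g hg => ?_, hgeom⟩
  have h := hgeom _ ((FreeAut.baseChange_mem_augSubgroup_iff (by omega)).mpr hg)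
  rwa [φ.geom_baseChange, FreeAut.baseChange_mem_augSubgroup_iff (by omega)] at h
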